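/- \textbf{Setting.} Let $N$ be a finite set of discrete random variables (each with a countable state space), and let $p$ be the joint distribution of a Bayesian network $(G,\Theta)$ on $N$, i.e. $p(x)=\prod_{v\in N}P_{\Theta}(x_v\mid x_{G_v})$, where $G_v$ is the set of parents of $v$ in the DAG $G$. All variables of the network are observed (causal sufficiency). Let $W=\{W_1,\dots,W_k\}$ be a partition of $N$ into nonempty groups and let $G'$ be a DAG with node set $W$. Assume that $p$ is \emph{groupwise faithful} to $G'$ given $W$: for all distinct $W_i,W_j\in W$ and all $T\subseteq W\setminus\{W_i,W_j\}$, the sets of variables $W_i$ and $W_j$ are conditionally independent given $\bigcup T$ in $p$ if and only if $W_i$ and $W_j$ are d-separated by $T$ in $G'$. \textbf{Algorithm} \textsc{FindGroupDAG1}. (1) Replace the variables in each group $W_j$ by one new variable $y_j$, whose states are the elements of the Cartesian product of the state spaces of the variables in $W_j$. (2) Run the PC algorithm on the variables $y_1,\dots,y_k$, visited in an arbitrary fixed order: starting from the complete undirected graph, for $\ell=0,1,2,\dots$ delete the edge between two adjacent variables $x,y$ as soon as a test accepts their independence given some set of $\ell$ current neighbours of $x$ other than $y$, and record that separating set; orient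 $x-y-z$ as $x\to y\leftarrow z$ for every $x\ne z$ that are not adjacent and whose recorded separating set does not contain $y$; apply the three standard orientation rules until none applies (orient $b-c$ as $b\to c$ if $a\to b$ with $a,c$ not adjacent, or if $b\to a\to c$, or if $b-a\to c$ and $b-d\to c$ with $a,d$ not adjacent); finally direct the remaining undirected edges by repeatedly choosing a remaining node $x$ that has no outgoing directed edge to a remaining node and such that every node joined to $x$ by an undirected edge is adjacent to all other remaining nodes adjacent to $x$, directing the undirected edges at $x$ towards $x$, and removing $x$ (the algorithm fails if there is no such $x$). Return the resulting directed graph. \textbf{Theorem.} In this setting, at infinite sample size \textsc{FindGroupDAG1} with the PC algorithm returns a DAG $H$ on $W$ that is Markov equivalent to $G'$ (that is, $H$ and $G'$ have the same d-separations). Precisely: (a) if the tests used by PC are exact, i.e. decide conditional independence of the $y_j$ in the distribution of $(y_1,\dots,y_k)$ induced by $p$, then the algorithm does not fail, and its output is a DAG that is Markov equivalent to $G'$; (b) if the algorithm is run on $n$ independent records from $p$ with any conditional independence test that is consistent at the induced distribution of $(y_1,\dots,y_k)$ (for all distinct $y_i,y_j$ and every set $S$ of other new variables, the probability that the test on $n$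 independent records decides correctly whether $y_i$ and $y_j$ are independent given $S$ tends to $1$ as $n\to\infty$), then the probability that the algorithm outputs a DAG that is Markov equivalent to $G'$ tends to $1$ as $n\to\infty$. -/

import Mathlib

/-! ### Directed acyclic graphs, d-separation, Markov equivalence -/

/-- A directed acyclic graph on the node type `V`; `Adj u v` is the arc from `u` to `v`. -/
structure DAG (V : Type*) extends Digraph V where
  acyclic : ∀ v, ¬ Relation.TransGen Adj v v

namespace DAG

variable {V : Type*}

/-- The skeleton: all arcs are replaced by undirected edges. -/
def skeleton (G : DAG V) : SimpleGraph V := SimpleGraph.fromRel G.Adj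

/-- The `i`-th node of the path `w` is a head-to-head node along `w`. -/
def HeadToHead (G : DAG V) {u v : V} (w : G.skeleton.Walk u v) (i : ℕ) : Prop :=
  0 < i ∧ i < w.length ∧
    G.Adj (w.getVert (i - 1)) (w.getVert i) ∧ G.Adj (w.getVert (i + 1)) (w.getVert i)

/-- `Z` d-connects the end nodes of `w` along `w`: every head-to-head node along `w` is in `Z` or
has a descendant in `Z`, and no other node along `w` is in `Z`. -/
def DConnectsAlong (G : DAG V) (Z : Set V) {u v : V} (w : G.skeleton.Walk u v) : Prop :=
  ∀ i ≤ w.length,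
    (G.HeadToHead w i → ∃ d ∈ Z, Relation.ReflTransGen G.Adj (w.getVert i) d) ∧
    (¬ G.HeadToHead w i → w.getVert i ∉ Z)

/-- `u` and `v` are d-separated by `Z`. -/
def DSep (G : DAG V) (u v : V) (Z : Set V) : Prop :=
  ∀ w : G.skeleton.Walk u v, w.IsPath → ¬ G.DConnectsAlong Z w

/-- Two DAGs are Markov equivalent if they imply the same conditional independence statements. -/
def MarkovEquivalent (G H : DAG V) : Prop :=
  ∀ (u v : V) (Z : Set V), u ≠ v → u ∉ Z → v ∉ Z → (G.DSep u v Z ↔ H.DSep u v Z)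

end DAG

/-! ### Distributions of finitely many discrete variables -/

section Distributions

variable {ι : Type*} {X : ι → Type*}

/-- The event that the variables in `A` have the values that they have in `a`. -/
def valueEvent (A : Finset ι) (a : ∀ i, X i) : Set (∀ i, X i) := {x | ∀ i ∈ A, x i = a i}

/-- The sets of discrete variables `A` and `B` are conditionally independent given `S`:
`P(A = a, B = b | S = s) = P(A = a | S = s) P(B = b | S = s)` whenever `P(S = s) ≠ 0`. -/
def CondIndepVars [∀ i, MeasurableSpace (X i)] (p : MeasureTheory.Measure (∀ i, X i))
    (A B S : Finset ι) : Prop :=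
  ∀ a b s : ∀ i, X i, p (valueEvent S s) ≠ 0 →
    ProbabilityTheory.cond p (valueEvent S s) (valueEvent A a ∩ valueEvent B b) =
      ProbabilityTheory.cond p (valueEvent S s) (valueEvent A a) *
        ProbabilityTheory.cond p (valueEvent S s) (valueEvent B b)

/-- A Bayesian network: a DAG and, for every node, a conditional distribution of the node for
every configuration of its parents. -/
structure BayesianNetwork (ι : Type*) (X : ι → Type*) where
  dag : DAG ι
  param : ∀ v, (∀ u : {u // dag.Adj u v}, X u) → PMF (X v)

/-- `p` is the joint distribution represented by the Bayesian network:
`p(x) = ∏ v, P(x_v | x_{parents of v})`. -/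
def BayesianNetwork.Represents [Fintype ι] [∀ i, MeasurableSpace (X i)]
    (B : BayesianNetwork ι X) (p : MeasureTheory.Measure (∀ i, X i)) : Prop :=
  ∀ x : ∀ i, X i, p {x} = ∏ v, B.param v (fun u => x u) (x v)

end Distributions

/-! ### Groupings -/

section Groupings

variable {N : Type*} [Fintype N] [DecidableEq N] {X : N → Type*}

/-- A grouping: a partition of the node set into nonempty groups. -/
abbrev Grouping (N : Type*) [Fintype N] [DecidableEq N] := Finpartition (Finset.univ : Finset N)

/-- The groups of a grouping, used as nodes of group DAGs. -/
abbrev Grouping.Group (W : Grouping N) : Type _ := {A : Finset N // A ∈ W.parts}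

/-- The distribution `p` is groupwise faithful to the group DAG `H` given the grouping `W`: for
distinct groups `I`, `J` and a set `T` of other groups, `I` and `J` are independent given `⋃ T`
in `p` if and only if they are d-separated by `T` in `H`. -/
def GroupwiseFaithful [∀ i, MeasurableSpace (X i)] (p : MeasureTheory.Measure (∀ i, X i))
    (W : Grouping N) (H : DAG W.Group) : Prop :=
  ∀ (I J : W.Group) (T : Finset W.Group), I ≠ J → I ∉ T → J ∉ T →
    (CondIndepVars p I.1 J.1 (T.biUnion fun K => K.1) ↔ H.DSep I J (T : Set W.Group))

/-- The states of the new variable of a group: the Cartesian product of the states of the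
variables in the group. -/
abbrev GroupState (X : N → Type*) (W : Grouping N) (J : W.Group) : Type _ :=
  ∀ i : {i // i ∈ J.1}, X i

/-- Conversion of the values of the variables into the values of the new variables. -/
def mergeGroups (W : Grouping N) (x : ∀ i, X i) : ∀ J : W.Group, GroupState X W J :=
  fun _ i => x i

end Groupings

/-! ### The PC algorithm

The algorithm is run with a conditional independence test `ci x y S` and with a list `order` of all
variables, which fixes the order in which pairs, triples and conditioning sets are visited. -/

namespace PC

variable {V : Type*} [DecidableEq V]

/-- The state of the skeleton search: current adjacencies and recorded separating sets. -/
structure SkelState (V : Type*) where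
  adj : V → V → Bool
  sep : V → V → Finset V

/-- Start with the complete undirected graph. -/
def skelInit : SkelState V where
  adj x y := decide (x ≠ y)
  sep _ _ := ∅

/-- Delete the edge between `x` and `y` and record the separating set `S`. -/
def deleteEdge (st : SkelState V) (x y : V) (S : Finset V) : SkelState V where
  adj u v := if (u = x ∧ v = y) ∨ (u = y ∧ v = x) then false else st.adj u v
  sep u v := if (u = x ∧ v = y) ∨ (u = y ∧ v = x) then S else st.sep u v

/-- If `x` and `y` are still adjacent, test them given the sets of `ℓ` neighbours of `x` other than
`y`, and delete the edge at the first independence that is found. -/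
def visitPair (order : List V) (ci : V → V → Finset V → Bool) (ℓ : ℕ) (st : SkelState V)
    (xy : V × V) : SkelState V :=
  if st.adj xy.1 xy.2 then
    match ((order.filter fun z => st.adj xy.1 z && decide (z ≠ xy.2)).sublistsLen ℓ).find?
        fun S => ci xy.1 xy.2 S.toFinset with
    | some S => deleteEdge st xy.1 xy.2 S.toFinset
    | none => st
  else st

/-- The skeleton search: all ordered pairs are visited for `ℓ = 0, 1, 2, …`. From
`ℓ = order.length` on there are no conditioning sets left. -/
def skeletonSearch (order : List V) (ci : V → V → Finset V → Bool) : SkelState V :=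
  (List.range order.length).foldl
    (fun st ℓ => (order ×ˢ order).foldl (visitPair order ci ℓ) st) skelInit

/-- Make the edge between `a` and `b` directed from `a` to `b`. In a partially directed graph `e`,
an edge is directed from `a` to `b` if `e a b` and not `e b a`, and undirected if both hold. -/
def orient (e : V → V → Bool) (a b : V) : V → V → Bool :=
  fun u v => if u = a ∧ v = b then true else if u = b ∧ v = a then false else e u v

/-- There is a directed edge from `a` to `b`. -/
def dir (e : V → V → Bool) (a b : V) : Bool := e a b && !e b a

/-- There is an undirected edge between `a` and `b`. -/
def und (e : V → V → Bool) (a b : V) : Bool := e a b && e b a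

/-- There is an edge between `a` and `b`. -/
def adjacent (e : V → V → Bool) (a b : V) : Bool := e a b || e b a

/-- Orient `x - y - z` as `x → y ← z` whenever `x`, `z` are distinct and not adjacent and `y` is not
in the separating set recorded for `x` and `z`. -/
def orientColliders (order : List V) (st : SkelState V) : V → V → Bool :=
  (order ×ˢ (order ×ˢ order)).foldl
    (fun e t =>
      if st.adj t.1 t.2.1 && st.adj t.2.2 t.2.1 && decide (t.1 ≠ t.2.2) && !st.adj t.1 t.2.2
          && decide (t.2.1 ∉ st.sep t.1 t.2.2)
      then orient (orient e t.1 t.2.1) t.2.2 t.2.1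
      else e)
    st.adj

/-- One of the three orientation rules allows to direct the undirected edge `b - c` from `b` to `c`:
`a → b` with `a`, `c` not adjacent; or `b → a → c`; or `b - a → c` and `b - d → c` with `a`, `d` not
adjacent. -/
def ruleApplies (order : List V) (e : V → V → Bool) (b c : V) : Bool :=
  und e b c && order.any fun a =>
    (dir e a b && !adjacent e a c && decide (a ≠ c)) ||
    (dir e b a && dir e a c) ||
    (und e b a && dir e a c && order.any fun d =>
      und e b d && dir e d c && !adjacent e a d && decide (a ≠ d))

/-- Orient the first edge to which a rule applies. -/
def ruleStep (order : List V) (e : V → V → Bool) : V → V → Bool :=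
  match (order ×ˢ order).find? fun bc => ruleApplies order e bc.1 bc.2 with
  | some bc => orient e bc.1 bc.2
  | none => e

/-- Apply the orientation rules until no more edges can be oriented; there are fewer than
`order.length ^ 2` edges. -/
def applyRules (order : List V) (e : V → V → Bool) : V → V → Bool :=
  (ruleStep order)^[order.length ^ 2] e

/-- Among the remaining nodes `R`, the node `x` has no outgoing directed edge, and every node joined
to `x` by an undirected edge is adjacent to all other nodes adjacent to `x`. -/
def isSink (e : V → V → Bool) (R : List V) (x : V) : Bool :=
  R.all fun y =>
    !dir e x y &&
      (!und e x y || R.all fun z => !adjacent e x z || decide (z = y) || adjacent e y z)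

/-- Direct the undirected edges between `x` and the nodes of `R` towards `x`. -/
def pointInto (e : V → V → Bool) (R : List V) (x : V) : V → V → Bool :=
  fun u v => if u = x ∧ v ∈ R ∧ und e x v then false else e u v

/-- Direct the remaining undirected edges by repeatedly removing a sink; `none` is a failure. -/
def extend : ℕ → List V → (V → V → Bool) → Option (V → V → Bool)
  | 0, _, e => some e
  | k + 1, R, e =>
    match R.find? (isSink e R) with
    | some x => extend k (R.erase x) (pointInto e R x)
    | none => none

/-- The edges of the directed graph returned by the PC algorithm. -/
def runEdges (order : List V) (ci : V → V → Finset V → Bool) : Option (V → V → Bool) :=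
  extend order.length order (applyRules order (orientColliders order (skeletonSearch order ci)))

/-- The PC algorithm: skeleton search, orientation of the v-structures, orientation rules, and
orientation of the remaining edges. It returns a directed graph or fails. -/
def run (order : List V) (ci : V → V → Finset V → Bool) : Option (Digraph V) :=
  (runEdges order ci).map fun e => ⟨fun u v => e u v = true⟩

end PC

/-! ### FindGroupDAG1 with the PC algorithm -/

section Algorithm

/-- A data-based conditional independence test: for a data set `D` of `n` records, `τ n D u v S` is
the decision whether the variables `u` and `v` are independent given the variables `S`. -/
abbrev CITest {V : Type*} (Y : V → Type*) : Type _ :=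
  ∀ n : ℕ, (Fin n → ∀ v, Y v) → V → V → Finset V → Bool

/-- The test is consistent at the distribution `q`: on `n` independent records from `q`, each of
its decisions is correct with a probability that tends to one. -/
def CITest.ConsistentAt {V : Type*} {Y : V → Type*} [∀ v, MeasurableSpace (Y v)] (τ : CITest Y)
    (q : MeasureTheory.Measure (∀ v, Y v)) [MeasureTheory.IsProbabilityMeasure q] : Prop :=
  ∀ (u v : V) (S : Finset V), u ≠ v → u ∉ S → v ∉ S →
    Filter.Tendsto
      (fun n : ℕ => MeasureTheory.Measure.pi (fun _ : Fin n => q)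
        {D | τ n D u v S = true ↔ CondIndepVars q {u} {v} S})
      Filter.atTop (nhds 1)

variable {N : Type*} [Fintype N] [DecidableEq N] {X : N → Type*}

/-- FindGroupDAG1 on a data set: the records are converted into records of the new variables, and
the PC algorithm is run on the converted data. -/
def findGroupDAG1 (W : Grouping N) (order : List W.Group) (τ : CITest (GroupState X W)) {n : ℕ}
    (D : Fin n → ∀ i, X i) : Option (Digraph W.Group) :=
  PC.run order (τ n fun t => mergeGroups W (D t))

open Classical in
/-- FindGroupDAG1 at infinite sample size: the independence test of the PC algorithm is exact
conditional independence of the new variables. -/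
noncomputable def findGroupDAG1Population [∀ i, MeasurableSpace (X i)] (W : Grouping N)
    (order : List W.Group) (p : MeasureTheory.Measure (∀ i, X i)) : Option (Digraph W.Group) :=
  PC.run order fun u v S =>
    decide (CondIndepVars (X := GroupState X W) (p.map (mergeGroups W)) {u} {v} S)

/-- The returned value is a DAG that is Markov equivalent to `H`. -/
def ReturnsMarkovEquivalent {V : Type*} (out : Option (Digraph V)) (H : DAG V) : Prop :=
  ∃ K : DAG V, out = some K.toDigraph ∧ K.MarkovEquivalent H

/-- The distribution of the new variables is a probability distribution. -/
instance mergeGroups_isProbabilityMeasure [∀ i, MeasurableSpace (X i)] (W : Grouping N)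
    (p : MeasureTheory.Measure (∀ i, X i)) [MeasureTheory.IsProbabilityMeasure p] :
    MeasureTheory.IsProbabilityMeasure (p.map (mergeGroups (X := X) W)) :=
  MeasureTheory.Measure.isProbabilityMeasure_map (by
    refine Measurable.aemeasurable ?_
    unfold mergeGroups
    fun_prop)

end Algorithm

/-! Merging each group into one variable turns conditional independence of groups into conditional
independence of single variables. By groupwise faithfulness, exact tests on the merged variables are
thus a d-separation oracle for G' (`GroupwiseFaithful.condIndepVars_iff`), and the core is the
correctness of PC with such an oracle (`PC.run_returnsMarkovEquivalent`).

The skeleton search keeps every edge of G', since adjacent nodes are never d-separated. It deletes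
all others: of two nonadjacent nodes, one is not a descendant of the other, and the parents of the
latter, always among its current neighbours, separate the two. The recorded sets then reveal the
unshielded colliders, and the rules only add directions that agree with G'. The final phase cannot
get stuck, because a node with no G'-child among the remaining nodes always qualifies; any
admissible choice creates no cycle and no new unshielded collider. The output therefore shares
skeleton and unshielded colliders with G'. This implies Markov equivalence
(`DAG.SamePattern.markovEquivalent`): a shortest active walk in one DAG becomes active in the other
once its colliders are suitably replaced.

For data, there are finitely many possible queries, so a consistent test answers all of them
correctly with probability tending to one. -/

namespace DAG

/-! ### d-separation through active walks -/

variable {V : Type*}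

lemma skeleton_adj (G : DAG V) {a b : V} : G.skeleton.Adj a b ↔ G.Adj a b ∨ G.Adj b a := by
  unfold skeleton
  rw [SimpleGraph.fromRel_adj]
  refine ⟨fun h => h.2, fun h => ⟨?_, h⟩⟩
  rintro rfl
  exact G.acyclic a (.single (h.elim id id))

lemma adj_asymm (G : DAG V) {a b : V} (h : G.Adj a b) : ¬ G.Adj b a := fun h' =>
  G.acyclic a (.tail (.single h) h')

lemma adj_trans_of_adj (G : DAG V) {a b c : V} (hab : G.Adj a b) (hbc : G.Adj b c)
    (hac : G.skeleton.Adj a c) : G.Adj a c :=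
  (G.skeleton_adj.1 hac).resolve_right fun h => G.acyclic a (.tail (.tail (.single hab) hbc) h)

/-- `v` is in `Z` or has a descendant in `Z`. -/
def Anc (G : DAG V) (Z : Set V) (v : V) : Prop := ∃ d ∈ Z, Relation.ReflTransGen G.Adj v d

lemma Anc.of_mem {G : DAG V} {Z : Set V} {v : V} (h : v ∈ Z) : G.Anc Z v := ⟨v, h, .refl⟩

lemma Anc.head {G : DAG V} {Z : Set V} {u v : V} (h : G.Anc Z v) (huv : G.Adj u v) :
    G.Anc Z u := by
  obtain ⟨d, hd, hvd⟩ := h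
  exact ⟨d, hd, .head huv hvd⟩

/-- The consecutive nodes `a`, `b`, `c` of a walk do not block it at `b`. -/
def OpenAt (G : DAG V) (Z : Set V) (a b c : V) : Prop :=
  (G.Adj a b ∧ G.Adj c b → G.Anc Z b) ∧ (¬ (G.Adj a b ∧ G.Adj c b) → b ∉ Z)

lemma OpenAt.of_anc {G : DAG V} {Z : Set V} {a b c : V} (h : G.Anc Z b) (hb : b ∉ Z) :
    G.OpenAt Z a b c := ⟨fun _ => h, fun _ => hb⟩

lemma OpenAt.symm {G : DAG V} {Z : Set V} {a b c : V} (h : G.OpenAt Z a b c) :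
    G.OpenAt Z c b a := ⟨fun h' => h.1 h'.symm, fun h' => h.2 fun h'' => h' h''.symm⟩

/-- `f 0, …, f n` is a walk, and no interior node of it is blocked by `Z`. -/
def Active (G : DAG V) (Z : Set V) (f : ℕ → V) (n : ℕ) : Prop :=
  (∀ i < n, G.skeleton.Adj (f i) (f (i + 1))) ∧
    ∀ i, i + 2 ≤ n → G.OpenAt Z (f i) (f (i + 1)) (f (i + 2))

variable {G H : DAG V} {Z : Set V} {f : ℕ → V} {n : ℕ}

lemma Active.reverse (h : G.Active Z f n) : G.Active Z (fun i => f (n - i)) n := by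
  refine ⟨fun i hi => ?_, fun i hi => ?_⟩
  · have := (h.1 (n - (i + 1)) (by omega)).symm
    rwa [show n - (i + 1) + 1 = n - i by omega] at this
  · have := (h.2 (n - (i + 2)) (by omega)).symm
    rwa [show n - (i + 2) + 1 = n - (i + 1) by omega,
      show n - (i + 2) + 2 = n - i by omega] at this

/-- Cutting out the nodes `i + 1, …, i + d` leaves only the new edge and the two triples at the seam
to check. For `i + d = n` the walk is merely truncated at `i`. -/
lemma Active.splice (h : G.Active Z f n) {i d : ℕ} (hid : i + d ≤ n)
    (hadj : i + d < n → G.skeleton.Adj (f i) (f (i + d + 1)))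
    (h₁ : ∀ m, m + 1 = i → i + d < n → G.OpenAt Z (f m) (f i) (f (i + d + 1)))
    (h₂ : i + d + 2 ≤ n → G.OpenAt Z (f i) (f (i + d + 1)) (f (i + d + 2))) :
    G.Active Z (fun k => if k ≤ i then f k else f (k + d)) (n - d) := by
  refine ⟨fun k hk => ?_, fun k hk => ?_⟩
  · rcases lt_trichotomy k i with hki | rfl | hki
    · simpa only [hki.le, if_true, show k + 1 ≤ i from hki] using h.1 k (by omega)
    · simpa only [le_refl, if_true, show ¬ (k + 1 ≤ k) by omega, if_false,
        show k + 1 + d = k + d + 1 by omega] using hadj (by omega)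
    · simpa only [show ¬ (k ≤ i) by omega, show ¬ (k + 1 ≤ i) by omega, if_false,
        show k + 1 + d = k + d + 1 by omega] using h.1 (k + d) (by omega)
  · rcases lt_trichotomy (k + 1) i with hki | rfl | hki
    · simpa only [show k ≤ i by omega, show k + 1 ≤ i by omega, show k + 2 ≤ i by omega, if_true]
        using h.2 k (by omega)
    · simpa only [le_refl, if_true, show k ≤ k + 1 by omega, show ¬ (k + 2 ≤ k + 1) by omega,
        if_false, show k + 2 + d = k + 1 + d + 1 by omega] using h₁ k rfl (by omega)
    · rcases Nat.lt_or_ge i k with hik | hik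
      · simpa only [show ¬ (k ≤ i) by omega, show ¬ (k + 1 ≤ i) by omega,
          show ¬ (k + 2 ≤ i) by omega, if_false, show k + 1 + d = k + d + 1 by omega,
          show k + 2 + d = k + d + 2 by omega] using h.2 (k + d) (by omega)
      · obtain rfl : k = i := by omega
        simpa only [le_refl, show ¬ (k + 1 ≤ k) by omega, show ¬ (k + 2 ≤ k) by omega, if_true,
          if_false, show k + 1 + d = k + d + 1 by omega,
          show k + 2 + d = k + d + 2 by omega] using h₂ (by omega)

/-- An active walk that starts with an outgoing arc is directed, or its first node is an ancestor
of `Z`. -/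
lemma Active.anc_or_transGen (h : G.Active Z f n) {i : ℕ} (hi : G.Adj (f i) (f (i + 1))) :
    ∀ k, i + k + 1 ≤ n → G.Anc Z (f i) ∨
      (Relation.TransGen G.Adj (f i) (f (i + k + 1)) ∧ G.Adj (f (i + k)) (f (i + k + 1)))
  | 0, _ => .inr ⟨.single hi, hi⟩
  | k + 1, hk => by
    rcases h.anc_or_transGen hi k (by omega) with h' | ⟨h₁, h₂⟩
    · exact .inl h'
    · rcases G.skeleton_adj.1 (h.1 (i + k + 1) (by omega)) with h₃ | h₃
      · exact .inr ⟨.tail h₁ h₃, h₃⟩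
      · obtain ⟨d, hd, hd'⟩ := (h.2 (i + k) (by omega)).1 ⟨h₂, h₃⟩
        exact .inl ⟨d, hd, h₁.to_reflTransGen.trans hd'⟩

/-- `f` is an active walk of minimal length among those with the same ends. -/
def MinActive (G : DAG V) (Z : Set V) (f : ℕ → V) (n : ℕ) : Prop :=
  G.Active Z f n ∧ ∀ g m, g 0 = f 0 → g m = f n → G.Active Z g m → n ≤ m

lemma Active.exists_minActive (h : G.Active Z f n) :
    ∃ g m, g 0 = f 0 ∧ g m = f n ∧ G.MinActive Z g m := by
  classical
  have hex : ∃ m, ∃ g, g 0 = f 0 ∧ g m = f n ∧ G.Active Z g m := ⟨n, f, rfl, rfl, h⟩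
  obtain ⟨g, h0, hn, hg⟩ := Nat.find_spec hex
  exact ⟨g, _, h0, hn, hg, fun g' m h0' hn' hg' =>
    Nat.find_min' hex ⟨g', h0'.trans h0, hn'.trans hn, hg'⟩⟩

lemma MinActive.splice_false (h : G.MinActive Z f n) {i d : ℕ} (hd : 0 < d) (hid : i + d ≤ n)
    (hn : i + d = n → f i = f n)
    (hadj : i + d < n → G.skeleton.Adj (f i) (f (i + d + 1)))
    (h₁ : ∀ m, m + 1 = i → i + d < n → G.OpenAt Z (f m) (f i) (f (i + d + 1)))
    (h₂ : i + d + 2 ≤ n → G.OpenAt Z (f i) (f (i + d + 1)) (f (i + d + 2))) : False := by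
  have := h.2 _ _ (by simp) ?_ (h.1.splice hid hadj h₁ h₂)
  · omega
  · by_cases hc : n - d ≤ i
    · simp only [hc, if_true]
      obtain rfl : i = n - d := by omega
      exact hn (by omega)
    · simp only [hc, if_false]
      congr 1
      omega

/-- Otherwise the loop between the two visits could be cut out. -/
lemma MinActive.ne (h : G.MinActive Z f n) {i j : ℕ} (hij : i < j) (hj : j ≤ n) :
    f i ≠ f j := by
  intro he
  obtain ⟨k, rfl⟩ : ∃ k, j = i + k + 1 := ⟨j - i - 1, by omega⟩
  refine h.splice_false (i := i) (d := k + 1) (by omega) (by omega) ?_ ?_ ?_ ?_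
  · intro hn
    rw [he, ← hn]; rfl
  · intro hn
    rw [he]
    exact h.1.1 (i + k + 1) (by omega)
  · rintro m rfl hn
    have hi := h.1.2 m (by omega)
    have hj := h.1.2 (m + 1 + k) (by omega)
    -- If the seam is a new collider, the loop starts with an outgoing arc, so its base is an
    -- ancestor of `Z` or lies on a directed cycle. If the base is in `Z`, both visits were
    -- colliders, hence so is the seam.
    refine ⟨fun hc => ?_, fun hc hZ => ?_⟩
    · by_cases hcol : G.Adj (f (m + 2)) (f (m + 1))
      · exact hi.1 ⟨hc.1, hcol⟩
      · have hout := (G.skeleton_adj.1 (h.1.1 (m + 1) (by omega))).resolve_right hcol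
        refine (h.1.anc_or_transGen hout k (by omega)).resolve_right fun hT => ?_
        rw [← he] at hT
        exact G.acyclic _ hT.1
    · have h1 : G.Adj (f m) (f (m + 1)) ∧ G.Adj (f (m + 2)) (f (m + 1)) := by
        by_contra h1
        exact hi.2 h1 hZ
      have h2 : G.Adj (f (m + 1 + k)) (f (m + 1 + k + 1)) ∧
          G.Adj (f (m + 1 + k + 2)) (f (m + 1 + k + 1)) := by
        by_contra h2
        exact hj.2 h2 (he ▸ hZ)
      rw [← he] at h2
      exact hc ⟨h1.1, h2.2⟩
  · intro hn
    have := h.1.2 (i + k + 1) (by omega)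
    rwa [← he] at this

lemma _root_.SimpleGraph.exists_walk_getVert {S : SimpleGraph V} :
    ∀ (n : ℕ) (f : ℕ → V), (∀ i < n, S.Adj (f i) (f (i + 1))) →
      ∃ w : S.Walk (f 0) (f n), w.length = n ∧ ∀ i ≤ n, w.getVert i = f i
  | 0, f, _ => ⟨.nil, rfl, fun i hi => by simp [Nat.le_zero.1 hi]⟩
  | n + 1, f, h => by
    obtain ⟨w, hw, hw'⟩ := SimpleGraph.exists_walk_getVert n (fun i => f (i + 1))
      fun i hi => h (i + 1) (by omega)
    refine ⟨.cons (h 0 (by omega)) w, by simp [hw], fun i hi => ?_⟩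
    cases i with
    | zero => simp
    | succ i => simpa using hw' i (by omega)

/-- d-connection by paths is the same as d-connection by walks. -/
lemma dSep_iff {u v : V} (hu : u ∉ Z) (hv : v ∉ Z) :
    G.DSep u v Z ↔ ∀ (f : ℕ → V) n, f 0 = u → f n = v → ¬ G.Active Z f n := by
  constructor
  · rintro h f n rfl rfl hf
    obtain ⟨g, m, h0, hm, hg⟩ := hf.exists_minActive
    rw [← h0, ← hm] at h
    rw [← h0] at hu
    rw [← hm] at hv
    obtain ⟨w, hw, hw'⟩ := SimpleGraph.exists_walk_getVert m g hg.1.1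
    refine h w ?_ fun i hi => ?_
    · rw [← SimpleGraph.Walk.IsPath.getVert_injOn_iff]
      intro i hi j hj hij
      simp only [Set.mem_ofPred_eq, hw] at hi hj
      rw [hw' i hi, hw' j hj] at hij
      rcases lt_trichotomy i j with hlt | rfl | hlt
      · exact absurd hij (hg.ne hlt hj)
      · rfl
      · exact absurd hij.symm (hg.ne hlt hi)
    · rw [hw] at hi
      unfold HeadToHead
      rw [hw, hw' i hi, hw' (i - 1) (by omega)]
      by_cases hin : 0 < i ∧ i < m
      · obtain ⟨k, rfl⟩ : ∃ k, i = k + 1 := ⟨i - 1, by omega⟩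
        rw [hw' (k + 1 + 1) (by omega)]
        have := hg.1.2 k (by omega)
        simp only [hin, true_and, Nat.add_sub_cancel]
        exact this
      · refine ⟨fun hc => absurd ⟨hc.1, hc.2.1⟩ hin, fun _ => ?_⟩
        rcases (show i = 0 ∨ i = m by omega) with rfl | rfl
        · exact hu
        · exact hv
  · intro h w _ hw
    refine h w.getVert w.length (by simp) (by simp)
      ⟨fun i hi => w.adj_getVert_succ hi, fun i hi => ?_⟩
    have := hw (i + 1) (by omega)
    unfold HeadToHead at this
    simpa [OpenAt, Anc, show i + 1 < w.length by omega] using this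

lemma DSep.symm {u v : V} (hu : u ∉ Z) (hv : v ∉ Z) (h : G.DSep u v Z) : G.DSep v u Z := by
  rw [dSep_iff hv hu]
  rw [dSep_iff hu hv] at h
  exact fun f n h0 hn hf => h _ n (by simpa using hn) (by simpa using h0) hf.reverse

lemma not_dSep_of_adj {u v : V} (hu : u ∉ Z) (hv : v ∉ Z) (h : G.skeleton.Adj u v) :
    ¬ G.DSep u v Z := by
  rw [dSep_iff hu hv]
  refine fun hs => hs (fun i => if i = 0 then u else v) 1 rfl rfl ⟨fun i hi => ?_, fun i hi => ?_⟩
  · obtain rfl : i = 0 := by omega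
    simpa using h
  · omega

/-- In a d-separated unshielded triple, the middle node is outside the separating set if and only
if it is a head-to-head node. -/
lemma DSep.notMem_iff {x y z : V} (hx : x ∉ Z) (hz : z ∉ Z) (hxy : G.skeleton.Adj x y)
    (hzy : G.skeleton.Adj z y) (h : G.DSep x z Z) : y ∉ Z ↔ G.Adj x y ∧ G.Adj z y := by
  have key : ¬ G.OpenAt Z x y z := by
    intro ho
    rw [dSep_iff hx hz] at h
    refine h (fun i => if i = 0 then x else if i = 1 then y else z) 2 rfl rfl
      ⟨fun i hi => ?_, fun i hi => ?_⟩
    · rcases (show i = 0 ∨ i = 1 by omega) with rfl | rfl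
      · simpa using hxy
      · simpa using hzy.symm
    · obtain rfl : i = 0 := by omega
      simpa using ho
  constructor
  · intro hy
    by_contra hc
    exact key ⟨fun h' => absurd h' hc, fun _ => hy⟩
  · intro hc hy
    exact key ⟨fun _ => .of_mem hy, fun h' => absurd hc h'⟩

/-- A node is d-separated by its parents from its nonadjacent nondescendants. -/
lemma dSep_parents {u v : V} (huv : ¬ G.skeleton.Adj u v) (hne : u ≠ v)
    (hdesc : ¬ Relation.TransGen G.Adj u v) : G.DSep u v {w | G.Adj w u} := by
  rw [dSep_iff (Z := {w | G.Adj w u}) (fun h => G.acyclic u (.single h))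
    fun h => huv (G.skeleton_adj.2 (.inr h))]
  rintro f n rfl rfl hf
  have hn : n ≠ 0 := fun h => hne (by rw [h])
  have hn1 : n ≠ 1 := fun h => huv (by rw [h]; exact hf.1 0 (by omega))
  -- Leaving `u` by an outgoing arc makes `u` an ancestor of its own parent or of `v`; leaving it by
  -- an incoming arc meets a parent as a noncollider in the separating set.
  rcases G.skeleton_adj.1 (hf.1 0 (by omega)) with h | h
  · rcases hf.anc_or_transGen (i := 0) h (n - 1) (by omega) with ⟨d, hd, hd'⟩ | h'
    · exact G.acyclic _ (.tail' hd' hd)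
    · rw [show 0 + (n - 1) + 1 = n by omega] at h'
      exact hdesc h'.1
  · exact (hf.2 0 (by omega)).2 (fun hc => G.adj_asymm h hc.1) h

/-! ### The characterization of Markov equivalence -/

/-- `G` and `H` have the same skeleton and the same unshielded head-to-head triples. -/
def SamePattern (G H : DAG V) : Prop :=
  (∀ a b, G.skeleton.Adj a b ↔ H.skeleton.Adj a b) ∧
    ∀ a b c, a ≠ c → ¬ G.skeleton.Adj a c →
      (G.Adj a b ∧ G.Adj c b ↔ H.Adj a b ∧ H.Adj c b)

lemma SamePattern.symm (h : G.SamePattern H) : H.SamePattern G :=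
  ⟨fun a b => (h.1 a b).symm,
    fun a b c hac hn => (h.2 a b c hac fun h' => hn ((h.1 _ _).1 h')).symm⟩

/-- A shielded collider could be bypassed. Its neighbours on the walk have arcs into it, so they
inherit an descendant in `Z`; being noncolliders they lie outside `Z`, and such nodes are open
whatever the adjacent arcs. -/
lemma MinActive.not_adj_of_collider (h : G.MinActive Z f n) {m : ℕ} (hm : m + 2 ≤ n)
    (h₁ : G.Adj (f m) (f (m + 1))) (h₂ : G.Adj (f (m + 2)) (f (m + 1))) :
    ¬ G.skeleton.Adj (f m) (f (m + 2)) := by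
  intro hadj
  have hanc := (h.1.2 m hm).1 ⟨h₁, h₂⟩
  refine h.splice_false (i := m) (d := 1) one_pos (by omega) (by omega) (fun _ => hadj) ?_ ?_
  · rintro k rfl _
    exact .of_anc (hanc.head h₁) ((h.1.2 k (by omega)).2 fun hc => G.adj_asymm h₁ hc.2)
  · intro hn
    exact .of_anc (hanc.head h₂) ((h.1.2 (m + 1) (by omega)).2 fun hc => G.adj_asymm h₂ hc.1)

/-- Only a shielded triple needs an argument. A neighbour that is a collider in `G` would be
unshielded, hence a collider in `H`, against the arcs of `H` into the middle. So both neighbours are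
noncolliders, and bypassing the middle keeps them so: a new collider there would, by acyclicity of
the triangle, make the middle a collider in `G`. -/
lemma MinActive.not_collider (h : G.MinActive Z f n) (hGH : G.SamePattern H) {m : ℕ}
    (hm : m + 2 ≤ n) (hc : ¬ (G.Adj (f m) (f (m + 1)) ∧ G.Adj (f (m + 2)) (f (m + 1)))) :
    ¬ (H.Adj (f m) (f (m + 1)) ∧ H.Adj (f (m + 2)) (f (m + 1))) := by
  by_cases hadj : G.skeleton.Adj (f m) (f (m + 2))
  swap
  · rwa [← hGH.2 _ _ _ (h.ne (by omega) hm) hadj]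
  intro hH
  have hleft : ∀ k, k + 1 = m → ¬ (G.Adj (f k) (f m) ∧ G.Adj (f (m + 1)) (f m)) := by
    rintro k rfl hk
    have := (hGH.2 _ _ _ (h.ne (by omega) (by omega))
      (h.not_adj_of_collider (by omega) hk.1 hk.2)).1 hk
    exact H.adj_asymm this.2 hH.1
  have hright : m + 3 ≤ n → ¬ (G.Adj (f (m + 1)) (f (m + 2)) ∧ G.Adj (f (m + 3)) (f (m + 2))) := by
    intro hn hk
    have := (hGH.2 _ _ _ (h.ne (by omega) (by omega))
      (h.not_adj_of_collider (m := m + 1) (by omega) hk.1 hk.2)).1 hk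
    exact H.adj_asymm this.1 hH.2
  have e₁ := G.skeleton_adj.1 (h.1.1 m (by omega))
  have e₂ := G.skeleton_adj.1 (h.1.1 (m + 1) (by omega))
  refine h.splice_false (i := m) (d := 1) one_pos (by omega) (by omega) (fun _ => hadj) ?_ ?_
  · intro k hk _
    refine ⟨fun hkc => ?_, fun _ => ?_⟩
    · exfalso
      have hout := e₁.resolve_right fun h' => hleft k hk ⟨hkc.1, h'⟩
      exact hc ⟨hout, G.adj_trans_of_adj hkc.2 hout (h.1.1 (m + 1) (by omega)).symm⟩
    · subst hk
      exact (h.1.2 k (by omega)).2 (hleft k rfl)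
  · intro hn
    refine ⟨fun hkc => ?_, fun _ => ?_⟩
    · exfalso
      have hout := e₂.resolve_left fun h' => hright hn ⟨h', hkc.2⟩
      exact hc ⟨G.adj_trans_of_adj hkc.1 hout (h.1.1 m (by omega)), hout⟩
    · exact (h.1.2 (m + 1) (by omega)).2 (hright hn)

/-- There is a directed walk of length `k` from `v` into `Z`. -/
def Reaches (G : DAG V) (Z : Set V) : ℕ → V → Prop
  | 0, v => v ∈ Z
  | k + 1, v => ∃ d, G.Adj v d ∧ G.Reaches Z k d

lemma Anc.exists_reaches {v : V} (h : G.Anc Z v) : ∃ k, G.Reaches Z k v := by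
  obtain ⟨d, hd, hvd⟩ := h
  induction hvd using Relation.ReflTransGen.head_induction_on with
  | refl => exact ⟨0, hd⟩
  | head hab _ ih =>
    obtain ⟨k, hk⟩ := ih
    exact ⟨k + 1, _, hab, hk⟩

/-- Along a shortest directed path to `Z` consecutive triples are unshielded. Once one arc has the
same direction in `H`, reversing the next would create a collider absent from `G`. -/
lemma SamePattern.anc_of_adj (hGH : G.SamePattern H) : ∀ (k : ℕ) (b d : V), G.Adj b d →
    H.Adj b d → G.Reaches Z k d → (∀ j < k + 1, ¬ G.Reaches Z j b) → H.Anc Z d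
  | 0, _, _, _, _, hd, _ => .of_mem hd
  | k + 1, b, d, hG, hH, ⟨d', hdd', hd'⟩, hmin => by
    have hb : ¬ G.skeleton.Adj b d' := fun h =>
      hmin (k + 1) (by omega) ⟨d', G.adj_trans_of_adj hG hdd' h, hd'⟩
    have hne : b ≠ d' := by
      rintro rfl
      exact G.adj_asymm hG hdd'
    have hH' : H.Adj d d' := by
      refine (H.skeleton_adj.1 ((hGH.1 _ _).1 (G.skeleton_adj.2 (.inl hdd')))).resolve_right ?_
      intro h
      exact G.adj_asymm hdd' ((hGH.2 b d d' hne hb).2 ⟨hH, h⟩).2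
    refine (hGH.anc_of_adj k d d' hdd' hH' hd' fun j hj hr => ?_).head hH'
    exact hmin (j + 1) (by omega) ⟨d, hG, hr⟩

/-- Let `b → d` start a shortest path to `Z`. If `H` keeps this arc, `b` itself works by
`anc_of_adj`. If `H` reverses it, `a` and `c` must both be adjacent to `d`, so `d` is a collider
between them that is closer to `Z`. -/
lemma SamePattern.exists_collider (hGH : G.SamePattern H) {a c : V} (hac : a ≠ c)
    (hadj : ¬ G.skeleton.Adj a c) : ∀ (k : ℕ) (b : V), G.Adj a b → G.Adj c b →
      G.Reaches Z k b → (∀ j < k, ¬ G.Reaches Z j b) →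
      ∃ b', G.Adj a b' ∧ G.Adj c b' ∧ H.Anc Z b'
  | 0, b, ha, hc, hb, _ => ⟨b, ha, hc, .of_mem hb⟩
  | k + 1, b, ha, hc, ⟨d, hbd, hd⟩, hmin => by
    rcases H.skeleton_adj.1 ((hGH.1 _ _).1 (G.skeleton_adj.2 (.inl hbd))) with h | h
    · exact ⟨b, ha, hc, (hGH.anc_of_adj k b d hbd h hd hmin).head h⟩
    · obtain ⟨ha', hc'⟩ := (hGH.2 a b c hac hadj).1 ⟨ha, hc⟩
      have key : ∀ x, G.Adj x b → H.Adj x b → G.Adj x d := by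
        intro x hG hH
        refine G.adj_trans_of_adj hG hbd ?_
        by_contra hx
        have hne : x ≠ d := by
          rintro rfl
          exact G.adj_asymm hG hbd
        exact G.adj_asymm hbd ((hGH.2 x b d hne hx).2 ⟨hH, h⟩).2
      exact hGH.exists_collider hac hadj k d (key a ha ha') (key c hc hc') hd
        fun j hj hr => hmin (j + 1) (by omega) ⟨d, hbd, hr⟩

lemma SamePattern.exists_active (hGH : G.SamePattern H) (h : G.MinActive Z f n) :
    ∃ g, g 0 = f 0 ∧ g n = f n ∧ H.Active Z g n := by
  classical
  let C : ℕ → Prop := fun m =>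
    m + 2 ≤ n ∧ G.Adj (f m) (f (m + 1)) ∧ G.Adj (f (m + 2)) (f (m + 1))
  have hrep : ∀ m, ∃ y, C m → G.Adj (f m) y ∧ G.Adj (f (m + 2)) y ∧ H.Anc Z y := by
    intro m
    by_cases hm : C m
    · have hex := ((h.1.2 m hm.1).1 hm.2).exists_reaches
      obtain ⟨y, hy⟩ := hGH.exists_collider (h.ne (by omega) hm.1)
        (h.not_adj_of_collider hm.1 hm.2.1 hm.2.2) _ _ hm.2.1 hm.2.2 (Nat.find_spec hex)
        fun j hj => Nat.find_min hex hj
      exact ⟨y, fun _ => hy⟩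
    · exact ⟨f 0, fun h' => absurd h' hm⟩
  choose r hr using hrep
  -- Colliders are never consecutive, so the replacements do not interfere. `C m` refers to the
  -- collider at position `m + 1`.
  let g : ℕ → V := fun i => if 0 < i ∧ C (i - 1) then r (i - 1) else f i
  have hg0 : g 0 = f 0 := by simp [g]
  have hgC : ∀ m, C m → g (m + 1) = r m := fun m hm => by simp [g, hm]
  have hgN : ∀ m, ¬ C m → g (m + 1) = f (m + 1) := fun m hm => by simp [g, hm]
  have hgl : ∀ m, C m → g m = f m := by
    intro m hm
    cases m with
    | zero => exact hg0
    | succ m => exact hgN m fun h' => G.adj_asymm h'.2.2 hm.2.1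
  have hgr : ∀ m, C m → g (m + 2) = f (m + 2) := fun m hm =>
    hgN (m + 1) fun h' => G.adj_asymm h'.2.1 hm.2.2
  have hH : ∀ m, C m → H.Adj (f m) (r m) ∧ H.Adj (f (m + 2)) (r m) := fun m hm =>
    (hGH.2 _ _ _ (h.ne (by omega) hm.1) (h.not_adj_of_collider hm.1 hm.2.1 hm.2.2)).1
      ⟨(hr m hm).1, (hr m hm).2.1⟩
  have hgn : g n = f n := by
    cases n with
    | zero => exact hg0
    | succ m => exact hgN m fun h' => by have := h'.1; omega
  refine ⟨g, hg0, hgn, fun i hi => ?_, fun i hi => ?_⟩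
  · by_cases h₁ : C i
    · rw [hgl i h₁, hgC i h₁]
      exact H.skeleton_adj.2 (.inl (hH i h₁).1)
    · rw [hgN i h₁]
      cases i with
      | zero => rw [hg0]; exact (hGH.1 _ _).1 (h.1.1 0 hi)
      | succ k =>
        by_cases h₂ : C k
        · rw [hgC k h₂]
          exact H.skeleton_adj.2 (.inr (hH k h₂).2)
        · rw [hgN k h₂]
          exact (hGH.1 _ _).1 (h.1.1 _ hi)
  · by_cases hC : C i
    · rw [hgl i hC, hgC i hC, hgr i hC]
      exact ⟨fun _ => (hr i hC).2.2, fun h' => absurd (hH i hC) h'⟩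
    · have hnc : ¬ (G.Adj (f i) (f (i + 1)) ∧ G.Adj (f (i + 2)) (f (i + 1))) :=
        fun h' => hC ⟨hi, h'⟩
      have hZ := (h.1.2 i hi).2 hnc
      rw [hgN i hC]
      refine ⟨fun hcol => absurd hcol ?_, fun _ => hZ⟩
      -- A replaced neighbour receives an arc of `H` from this node, which therefore is no collider;
      -- with no replaced neighbour, `not_collider` applies.
      by_cases h₂ : C (i + 1)
      · rw [hgC (i + 1) h₂]
        exact fun hcol => H.adj_asymm hcol.2 (hH (i + 1) h₂).1
      · rw [hgN (i + 1) h₂]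
        cases i with
        | zero => rw [hg0]; exact h.not_collider hGH hi hnc
        | succ k =>
          by_cases h₃ : C k
          · rw [hgC k h₃]
            exact fun hcol => H.adj_asymm hcol.1 (hH k h₃).2
          · rw [hgN k h₃]
            exact h.not_collider hGH hi hnc

lemma SamePattern.dSep (hGH : G.SamePattern H) {u v : V} (hu : u ∉ Z) (hv : v ∉ Z)
    (h : H.DSep u v Z) : G.DSep u v Z := by
  rw [dSep_iff hu hv] at h ⊢
  rintro f n rfl rfl hf
  obtain ⟨g, m, h0, hm, hg⟩ := hf.exists_minActive
  obtain ⟨g', h0', hm', hg'⟩ := hGH.exists_active hg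
  exact h g' m (h0'.trans h0) (hm'.trans hm) hg'

/-- DAGs with the same skeleton and the same unshielded head-to-head triples are Markov
equivalent. -/
theorem SamePattern.markovEquivalent (hGH : G.SamePattern H) : G.MarkovEquivalent H :=
  fun _ _ _ _ hu hv => ⟨hGH.symm.dSep hu hv, hGH.dSep hu hv⟩

end DAG

/-! ### Invariants of folds -/

section Folds

variable {α β : Type*} {f : β → α → β} {P Q : β → Prop}

lemma List.foldl_invariant {l : List α} (h : ∀ s, ∀ a ∈ l, P s → P (f s a)) {s : β} (hs : P s) :
    P (l.foldl f s) := by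
  induction l generalizing s with
  | nil => exact hs
  | cons a l ih =>
    exact ih (fun s b hb => h s b (List.mem_cons_of_mem _ hb)) (h s a List.mem_cons_self hs)

/-- A step of a fold that establishes `Q` does so for good if the other steps preserve `Q`. -/
lemma List.foldl_of_mem {l : List α} {a : α} (ha : a ∈ l) (hP : ∀ s, ∀ b ∈ l, P s → P (f s b))
    (hQ : ∀ s, ∀ b ∈ l, P s → Q s → Q (f s b)) (hPQ : ∀ s, P s → Q (f s a)) {s : β} (hs : P s) :
    Q (l.foldl f s) := by
  obtain ⟨l₁, l₂, rfl⟩ := List.append_of_mem ha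
  rw [List.foldl_append, List.foldl_cons]
  have h₁ : P (l₁.foldl f s) :=
    List.foldl_invariant (fun s b hb => hP s b (by simp [hb])) hs
  exact (List.foldl_invariant (P := fun s => P s ∧ Q s)
    (fun s b hb h => ⟨hP s b (by simp [hb]) h.1, hQ s b (by simp [hb]) h.1 h.2⟩)
    ⟨hP _ a ha h₁, hPQ _ h₁⟩).2

end Folds

/-! ### Correctness of PC with a d-separation oracle -/

namespace PC

variable {V : Type*} [DecidableEq V] {G : DAG V} {order : List V}
  {ci : V → V → Finset V → Bool}

/-- The test decides d-separation in `G`. -/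
def Decides (ci : V → V → Finset V → Bool) (G : DAG V) : Prop :=
  ∀ (u v : V) (S : Finset V), u ≠ v → u ∉ S → v ∉ S → (ci u v S = true ↔ G.DSep u v S)

/-! ### The skeleton search -/

/-- No edge of the skeleton has been deleted, and the recorded sets are separating sets. -/
structure SkelSound (G : DAG V) (st : SkelState V) : Prop where
  irrefl : ∀ x, st.adj x x = false
  symm : ∀ x y, st.adj x y = st.adj y x
  of_adj : ∀ x y, G.skeleton.Adj x y → st.adj x y = true
  sep : ∀ x y, x ≠ y → st.adj x y = false →
    x ∉ st.sep x y ∧ y ∉ st.sep x y ∧ G.DSep x y (st.sep x y)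

lemma skelSound_skelInit : SkelSound G (skelInit : SkelState V) where
  irrefl x := by simp [skelInit]
  symm x y := by simp [skelInit, eq_comm]
  of_adj x y h := by simp [skelInit, h.ne]
  sep x y hxy h := by simp [skelInit, hxy] at h

lemma SkelSound.deleteEdge {st : SkelState V} (h : SkelSound G st) {x y : V} {S : Finset V}
    (hx : x ∉ S) (hy : y ∉ S) (hS : G.DSep x y S) : SkelSound G (deleteEdge st x y S) where
  irrefl u := by simp [PC.deleteEdge, h.irrefl]
  symm u v := by
    simp only [PC.deleteEdge, h.symm u v]
    congr 1
    grind
  of_adj u v huv := by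
    simp only [PC.deleteEdge]
    split_ifs with hc
    · exfalso
      rcases hc with ⟨rfl, rfl⟩ | ⟨rfl, rfl⟩
      · exact DAG.not_dSep_of_adj hx hy huv hS
      · exact DAG.not_dSep_of_adj hx hy huv.symm hS
    · exact h.of_adj u v huv
  sep u v huv hadj := by
    simp only [PC.deleteEdge] at hadj ⊢
    split_ifs at hadj ⊢ with hc
    · rcases hc with ⟨rfl, rfl⟩ | ⟨rfl, rfl⟩
      · exact ⟨hx, hy, hS⟩
      · exact ⟨hy, hx, hS.symm hx hy⟩
    · exact h.sep u v huv hadj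

/-- The conditioning sets that are tried for an ordered pair. -/
lemma notMem_of_mem_sublistsLen {st : SkelState V} (h : SkelSound G st) {x y : V} {ℓ : ℕ}
    {S : List V}
    (hS : S ∈ (order.filter fun z => st.adj x z && decide (z ≠ y)).sublistsLen ℓ) :
    x ∉ S.toFinset ∧ y ∉ S.toFinset := by
  have hsub := (List.mem_sublistsLen.1 hS).1.subset
  simp only [List.mem_toFinset]
  refine ⟨fun hx => ?_, fun hy => ?_⟩
  · simpa [h.irrefl] using hsub hx
  · simpa using hsub hy

lemma SkelSound.visitPair {st : SkelState V} (h : SkelSound G st) (hci : Decides ci G) (ℓ : ℕ)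
    (xy : V × V) : SkelSound G (visitPair order ci ℓ st xy) := by
  unfold PC.visitPair
  split_ifs with hadj
  · split
    · rename_i S hS
      obtain ⟨hx, hy⟩ := notMem_of_mem_sublistsLen h (List.mem_of_find?_eq_some hS)
      have hne : xy.1 ≠ xy.2 := fun he => by simp [he, h.irrefl] at hadj
      exact h.deleteEdge hx hy ((hci _ _ _ hne hx hy).1
        (List.find?_some (p := fun S : List V => ci xy.1 xy.2 S.toFinset) hS))
    · exact h
  · exact h

lemma visitPair_adj_eq_false {st : SkelState V} {ℓ : ℕ} {xy : V × V} {x y : V}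
    (h : st.adj x y = false) : (visitPair order ci ℓ st xy).adj x y = false := by
  unfold visitPair
  split_ifs
  · split
    · simp [deleteEdge, h]
    · exact h
  · exact h

/-- True neighbours of `x` are never lost, so `Z` is among the sets tried; the edge goes at `Z` or
at an earlier success. -/
lemma SkelSound.visitPair_adj {st : SkelState V}
    (h : SkelSound G st) (hci : Decides ci G) {x y : V} {Z : List V} (hZ : Z.Sublist order)
    (hZx : ∀ z ∈ Z, G.skeleton.Adj x z) (hy : y ∉ Z) (hsep : G.DSep x y (Z.toFinset : Set V)) :
    (PC.visitPair order ci Z.length st (x, y)).adj x y = false := by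
  unfold PC.visitPair
  split_ifs with hadj
  · have hne : x ≠ y := fun he => by simp [he, h.irrefl] at hadj
    have hmem : Z ∈ (order.filter fun z => st.adj x z && decide (z ≠ y)).sublistsLen Z.length := by
      refine List.mem_sublistsLen_self ?_
      have : Z.filter (fun z => st.adj x z && decide (z ≠ y)) = Z := by
        refine List.filter_eq_self.2 fun z hz => ?_
        simpa [h.of_adj x z (hZx z hz)] using ne_of_mem_of_not_mem hz hy
      rw [← this]
      exact hZ.filter _
    obtain ⟨hx', hy'⟩ := notMem_of_mem_sublistsLen h hmem
    have htest := (hci _ _ _ hne hx' hy').2 hsep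
    split
    · simp [PC.deleteEdge]
    · rename_i hnone
      exact absurd htest (List.find?_eq_none.1 hnone Z hmem)
  · simpa using hadj

lemma skelSound_skeletonSearch (hci : Decides ci G) :
    SkelSound G (skeletonSearch order ci) :=
  List.foldl_invariant (fun _ ℓ _ h => List.foldl_invariant (fun _ xy _ h => h.visitPair hci ℓ xy) h)
    skelSound_skelInit

lemma skeletonSearch_adj_eq_false (horder : ∀ v, v ∈ order) (hci : Decides ci G) {x y : V}
    (hne : x ≠ y) (hxy : ¬ G.skeleton.Adj x y) (hdesc : ¬ Relation.TransGen G.Adj x y) :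
    (skeletonSearch order ci).adj x y = false := by
  classical
  set Z := order.filter fun w => decide (G.Adj w x) with hZdef
  have hmem : ∀ w, w ∈ Z ↔ G.Adj w x := fun w => by simp [hZdef, horder w]
  -- A node is not its own parent, so the round for its number of parents is reached.
  have hlen : Z.length < order.length := by
    rw [hZdef, List.length_filter_lt_length_iff_exists]
    exact ⟨x, horder x, by simpa using fun h => G.acyclic x (.single h)⟩
  have hcoe : (Z.toFinset : Set V) = {w | G.Adj w x} := by
    ext w
    simp [hmem]
  have hsound : ∀ st : SkelState V, ∀ ℓ ∈ List.range order.length, SkelSound G st →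
      SkelSound G ((order ×ˢ order).foldl (visitPair order ci ℓ) st) :=
    fun st ℓ _ h => List.foldl_invariant (fun _ xy _ h => h.visitPair hci ℓ xy) h
  refine List.foldl_of_mem (P := SkelSound G) (Q := fun st : SkelState V => st.adj x y = false)
    (List.mem_range.2 hlen) hsound ?_ ?_ skelSound_skelInit
  · exact fun st ℓ _ _ h => List.foldl_invariant (P := fun st : SkelState V => st.adj x y = false)
      (fun _ _ _ h => visitPair_adj_eq_false h) h
  · intro st hst
    refine List.foldl_of_mem (P := SkelSound G) (Q := fun st : SkelState V => st.adj x y = false)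
      (List.mem_product.2 ⟨horder x, horder y⟩) (fun _ xy _ h => h.visitPair hci _ xy)
      (fun _ _ _ _ h => visitPair_adj_eq_false h) (fun st h => ?_) hst
    refine h.visitPair_adj hci List.filter_sublist (fun z hz => ?_) (fun hy => ?_) ?_
    · exact G.skeleton_adj.2 (.inr ((hmem z).1 hz))
    · exact hxy (G.skeleton_adj.2 (.inr ((hmem y).1 hy)))
    · rw [hcoe]
      exact DAG.dSep_parents hxy hne hdesc

/-- With exact tests, the skeleton search finds the skeleton. -/
lemma skeletonSearch_adj_iff (horder : ∀ v, v ∈ order) (hci : Decides ci G) {x y : V} :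
    (skeletonSearch order ci).adj x y = true ↔ G.skeleton.Adj x y := by
  have hs := skelSound_skeletonSearch (order := order) hci
  refine ⟨fun h => ?_, hs.of_adj x y⟩
  by_contra hxy
  have hne : x ≠ y := fun he => by simp [he, hs.irrefl] at h
  by_cases hdesc : Relation.TransGen G.Adj x y
  · have := skeletonSearch_adj_eq_false horder hci hne.symm (fun h => hxy h.symm)
      fun h' => G.acyclic x (hdesc.trans h')
    rw [hs.symm, this] at h
    cases h
  · rw [skeletonSearch_adj_eq_false horder hci hne hxy hdesc] at h
    cases h

/-! ### Orientations -/

/-- `G` is obtained from the partially directed graph `e` by directing undirected edges. -/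
structure Extends (G : DAG V) (e : V → V → Bool) : Prop where
  of_adj : ∀ a b, G.Adj a b → e a b = true
  adj : ∀ a b, e a b = true → G.skeleton.Adj a b

lemma Extends.orient {e : V → V → Bool} (h : Extends G e) {a b : V} (hab : G.Adj a b) :
    Extends G (orient e a b) where
  of_adj u v huv := by
    unfold PC.orient
    split_ifs with h₁ h₂
    · rfl
    · exact absurd hab (h₂.1 ▸ h₂.2 ▸ G.adj_asymm huv)
    · exact h.of_adj u v huv
  adj u v huv := by
    unfold PC.orient at huv
    split_ifs at huv with h₁ h₂
    · rw [h₁.1, h₁.2]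
      exact G.skeleton_adj.2 (.inl hab)
    · exact h.adj u v huv

lemma Extends.adjacent_iff {V : Type*} {G : DAG V} {e : V → V → Bool} (h : Extends G e) {a b : V} :
    adjacent e a b = true ↔ G.skeleton.Adj a b := by
  unfold adjacent
  rw [Bool.or_eq_true]
  refine ⟨fun h' => h'.elim (h.adj a b) fun h' => (h.adj b a h').symm, fun h' => ?_⟩
  exact (G.skeleton_adj.1 h').imp (h.of_adj a b) (h.of_adj b a)

lemma Extends.adj_of_dir {V : Type*} {G : DAG V} {e : V → V → Bool} (h : Extends G e)
    {a b : V} (hab : dir e a b = true) :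
    G.Adj a b := by
  simp only [dir, Bool.and_eq_true, Bool.not_eq_true'] at hab
  refine (G.skeleton_adj.1 (h.adj a b hab.1)).resolve_right fun hba => ?_
  simp [h.of_adj b a hba] at hab

lemma orient_eq_false {e : V → V → Bool} {a b u v : V} (hab : G.Adj a b) (huv : G.Adj u v)
    (h : e v u = false) : orient e a b v u = false := by
  unfold orient
  split_ifs with h₁
  · exact absurd hab (h₁.1 ▸ h₁.2 ▸ G.adj_asymm huv)
  · rfl
  · exact h

/-- The unshielded head-to-head triples of `G` are directed in `e`. -/
def CollidersDirected (G : DAG V) (e : V → V → Bool) : Prop :=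
  ∀ x y z, x ≠ z → ¬ G.skeleton.Adj x z → G.Adj x y → G.Adj z y → e y x = false

lemma CollidersDirected.orient {e : V → V → Bool} (h : CollidersDirected G e) {a b : V}
    (hab : G.Adj a b) : CollidersDirected G (orient e a b) :=
  fun x y z hxz hn hx hz => orient_eq_false hab hx (h x y z hxz hn hx hz)

lemma collider_condition_iff (horder : ∀ v, v ∈ order) (hci : Decides ci G) {x y z : V} :
    ((skeletonSearch order ci).adj x y && (skeletonSearch order ci).adj z y && decide (x ≠ z) &&
      !(skeletonSearch order ci).adj x z && decide (y ∉ (skeletonSearch order ci).sep x z)) = true ↔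
    x ≠ z ∧ ¬ G.skeleton.Adj x z ∧ G.Adj x y ∧ G.Adj z y := by
  have hs := skelSound_skeletonSearch (order := order) hci
  simp only [Bool.and_eq_true, decide_eq_true_eq, Bool.not_eq_true', ← Bool.not_eq_true,
    skeletonSearch_adj_iff horder hci]
  constructor
  · rintro ⟨⟨⟨⟨hxy, hzy⟩, hxz⟩, hn⟩, hy⟩
    have hf := hn
    rw [← skeletonSearch_adj_iff horder hci, Bool.not_eq_true] at hf
    obtain ⟨hx, hz, hsep⟩ := hs.sep x z hxz hf
    exact ⟨hxz, hn, (hsep.notMem_iff hx hz hxy hzy).1 hy⟩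
  · rintro ⟨hxz, hn, hxy, hzy⟩
    have hf := hn
    rw [← skeletonSearch_adj_iff horder hci, Bool.not_eq_true] at hf
    obtain ⟨hx, hz, hsep⟩ := hs.sep x z hxz hf
    have hxy' := G.skeleton_adj.2 (.inl hxy)
    have hzy' := G.skeleton_adj.2 (.inl hzy)
    exact ⟨⟨⟨⟨hxy', hzy'⟩, hxz⟩, hn⟩, (hsep.notMem_iff hx hz hxy' hzy').2 ⟨hxy, hzy⟩⟩

/-- Every orientation made is an arc of `G`, so no later step reverses an earlier one. -/
lemma orientColliders_spec (horder : ∀ v, v ∈ order) (hci : Decides ci G) :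
    Extends G (orientColliders order (skeletonSearch order ci)) ∧
      CollidersDirected G (orientColliders order (skeletonSearch order ci)) := by
  have hinit : Extends G (skeletonSearch order ci).adj :=
    ⟨fun a b h => (skeletonSearch_adj_iff horder hci).2 (G.skeleton_adj.2 (.inl h)),
      fun a b h => (skeletonSearch_adj_iff horder hci).1 h⟩
  unfold orientColliders
  have hor := fun e (t : V × V × V) (he : Extends G e)
      (hc : t.1 ≠ t.2.2 ∧ ¬ G.skeleton.Adj t.1 t.2.2 ∧ G.Adj t.1 t.2.1 ∧ G.Adj t.2.2 t.2.1) =>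
    (he.orient hc.2.2.1).orient hc.2.2.2
  refine ⟨List.foldl_invariant (fun e t _ he => ?_) hinit, fun x y z hxz hn hxy hzy => ?_⟩
  · split_ifs with hc
    · exact hor e t he ((collider_condition_iff horder hci).1 hc)
    · exact he
  refine List.foldl_of_mem (P := Extends G) (Q := fun e => e y x = false) (a := (x, y, z))
    (by simp [horder]) (fun e t _ he => ?_) (fun e t _ _ he => ?_) (fun e _ => ?_) hinit
  · split_ifs with hc
    · exact hor e t he ((collider_condition_iff horder hci).1 hc)
    · exact he
  · split_ifs with hc
    · have hc' := (collider_condition_iff horder hci).1 hc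
      exact orient_eq_false hc'.2.2.2 hxy (orient_eq_false hc'.2.2.1 hxy he)
    · exact he
  · rw [if_pos ((collider_condition_iff horder hci).2 ⟨hxz, hn, hxy, hzy⟩)]
    refine orient_eq_false hzy hxy ?_
    have : y ≠ x := by
      rintro rfl
      exact G.acyclic _ (.single hxy)
    simp [orient, this]

/-- The orientation rules are sound. -/
lemma adj_of_ruleApplies {e : V → V → Bool} (he : Extends G e) (hc : CollidersDirected G e)
    {b c : V} (h : ruleApplies order e b c = true) : G.Adj b c := by
  simp only [ruleApplies, Bool.and_eq_true, List.any_eq_true, Bool.or_eq_true, Bool.not_eq_true',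
    decide_eq_true_eq, ← Bool.not_eq_true, he.adjacent_iff] at h
  obtain ⟨hbc, a, -, h⟩ := h
  simp only [und, Bool.and_eq_true] at hbc
  refine (G.skeleton_adj.1 (he.adj b c hbc.1)).resolve_right fun hcb => ?_
  rcases h with (⟨⟨hab, hac⟩, hne⟩ | ⟨hba, hac⟩) | ⟨⟨hba, hac⟩, d, -, ⟨⟨hbd, hdc⟩, had⟩, hne⟩
  · have := hc c b a (Ne.symm hne) (fun h => hac h.symm) hcb (he.adj_of_dir hab)
    simp [this] at hbc
  · exact G.acyclic b (.tail (.tail (.single (he.adj_of_dir hba)) (he.adj_of_dir hac)) hcb)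
  · simp only [und, Bool.and_eq_true] at hba hbd
    -- With `c → b`, acyclicity forces `a → b ← d`, an unshielded collider, which would already be
    -- directed.
    have hab := G.adj_trans_of_adj (he.adj_of_dir hac) hcb (he.adj a b hba.2)
    have hdb := G.adj_trans_of_adj (he.adj_of_dir hdc) hcb (he.adj d b hbd.2)
    simp [hc a b d hne had hab hdb] at hba

/-- Soundness of the rules suffices; that they reach a fixed point plays no role. -/
lemma applyRules_spec {e : V → V → Bool} (he : Extends G e) (hc : CollidersDirected G e) :
    Extends G (applyRules order e) ∧ CollidersDirected G (applyRules order e) := by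
  unfold applyRules
  refine Function.Iterate.rec (f := ruleStep order)
    (fun e => Extends G e ∧ CollidersDirected G e) ⟨he, hc⟩ ?_ _
  rintro e ⟨he, hc⟩
  unfold ruleStep
  split
  · rename_i bc hbc
    have := adj_of_ruleApplies he hc
      (List.find?_some (p := fun bc : V × V => ruleApplies order e bc.1 bc.2) hbc)
    exact ⟨he.orient this, hc.orient this⟩
  · exact ⟨he, hc⟩

/-! ### Directing the remaining edges -/

/-- A node with no `G`-descendant in `R` qualifies: two nonadjacent neighbours would form an
unshielded collider at it, whose edges are already directed. -/
lemma exists_isSink [Finite V] {e : V → V → Bool} {R : List V} (hR : R ≠ [])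
    (he : ∀ a ∈ R, ∀ b ∈ R, G.Adj a b → e a b = true)
    (he' : ∀ a ∈ R, ∀ b ∈ R, e a b = true → G.skeleton.Adj a b)
    (hc : ∀ x ∈ R, ∀ y ∈ R, ∀ z ∈ R, x ≠ z → ¬ G.skeleton.Adj x z → G.Adj x y → G.Adj z y →
      e y x = false) : ∃ x ∈ R, isSink e R x = true := by
  have hwf : WellFounded fun a b => Relation.TransGen G.Adj b a := by
    have : IsTrans V fun a b => Relation.TransGen G.Adj b a := ⟨fun _ _ _ h h' => h'.trans h⟩
    have : Std.Irrefl fun a b => Relation.TransGen G.Adj b a := ⟨G.acyclic⟩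
    exact Finite.wellFounded_of_trans_of_irrefl _
  obtain ⟨x, hx, hmin⟩ := hwf.has_min {v | v ∈ R} (List.exists_mem_of_ne_nil R hR)
  have hin : ∀ y ∈ R, (e x y = true ∨ e y x = true) → G.Adj y x := by
    intro y hy h
    have hs : G.skeleton.Adj x y := h.elim (he' x hx y hy) fun h => (he' y hy x hx h).symm
    exact (G.skeleton_adj.1 hs).resolve_left fun h => hmin y hy (.single h)
  refine ⟨x, hx, ?_⟩
  simp only [isSink, List.all_eq_true, Bool.and_eq_true, Bool.or_eq_true, Bool.not_eq_true',
    decide_eq_true_eq]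
  refine fun y hy => ⟨?_, ?_⟩
  · by_contra hd
    simp only [dir, Bool.not_eq_false, Bool.and_eq_true, Bool.not_eq_true'] at hd
    simp [he y hy x hx (hin y hy (.inl hd.1))] at hd
  · by_cases hu : und e x y = true
    swap
    · exact .inl (by simpa using hu)
    refine .inr fun z hz => ?_
    by_contra hcon
    simp only [not_or, Bool.not_eq_false, Bool.not_eq_true] at hcon
    obtain ⟨⟨hxz, hzy⟩, hyz⟩ := hcon
    simp only [und, Bool.and_eq_true] at hu
    simp only [adjacent, Bool.or_eq_true] at hxz
    simp only [adjacent, Bool.or_eq_false_iff] at hyz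
    have hn : ¬ G.skeleton.Adj y z := by
      intro h
      rcases G.skeleton_adj.1 h with h | h
      · simp [he y hy z hz h] at hyz
      · simp [he z hz y hy h] at hyz
    simp [hc y hy x hx z hz (Ne.symm hzy) hn (hin y hy (.inl hu.1)) (hin z hz hxz)] at hu

/-- If `G` extends the partially directed graph, then directing the undirected edges succeeds and
gives an acyclic graph with the skeleton and the unshielded head-to-head triples of `G`. -/
lemma extend_spec [Finite V] : ∀ (k : ℕ) (R : List V) (e : V → V → Bool), R.length = k → R.Nodup →
    (∀ a ∈ R, ∀ b ∈ R, G.Adj a b → e a b = true) →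
    (∀ a ∈ R, ∀ b ∈ R, e a b = true → G.skeleton.Adj a b) →
    (∀ x ∈ R, ∀ y ∈ R, ∀ z ∈ R, x ≠ z → ¬ G.skeleton.Adj x z → G.Adj x y → G.Adj z y →
      e y x = false) →
    ∃ e', extend k R e = some e' ∧ (∀ u v, (u ∉ R ∨ v ∉ R) → e' u v = e u v) ∧
      (∀ u ∈ R, ∀ v ∈ R, (e' u v = true ∨ e' v u = true ↔ G.skeleton.Adj u v)) ∧
      (∀ u ∈ R, ∀ v ∈ R, e' u v = true → e u v = true) ∧
      (∃ r : V → ℕ, ∀ u ∈ R, ∀ v ∈ R, e' u v = true → r v < r u) ∧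
      (∀ a ∈ R, ∀ b ∈ R, ∀ c ∈ R, a ≠ c → ¬ G.skeleton.Adj a c → e' a b = true → e' c b = true →
        G.Adj a b ∧ G.Adj c b)
  | 0, R, e, hk, _, _, _, _ => by
    obtain rfl := List.length_eq_zero_iff.1 hk
    exact ⟨e, rfl, fun _ _ _ => rfl, by simp, by simp, ⟨fun _ => 0, by simp⟩, by simp⟩
  | k + 1, R, e, hk, hnd, he, he', hc => by
    obtain ⟨x₀, hx₀, hs₀⟩ := exists_isSink (List.ne_nil_of_length_eq_add_one hk) he he' hc
    obtain ⟨x, hfind⟩ : ∃ x, R.find? (isSink e R) = some x :=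
      Option.isSome_iff_exists.1 (List.find?_isSome.2 ⟨x₀, hx₀, hs₀⟩)
    have hxR := List.mem_of_find?_eq_some hfind
    have hsink := List.find?_some hfind
    simp only [isSink, List.all_eq_true, Bool.and_eq_true, Bool.or_eq_true, Bool.not_eq_true',
      decide_eq_true_eq] at hsink
    have hmem : ∀ v, v ∈ R.erase x ↔ v ≠ x ∧ v ∈ R := fun v => hnd.mem_erase_iff
    have hp : ∀ u v, u ≠ x → pointInto e R x u v = e u v := fun u v hu => by
      simp [pointInto, hu]
    have hsym : ∀ v ∈ R, e x v = true → e v x = true := by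
      intro v hv h
      by_contra h'
      simpa [dir, h, h'] using (hsink v hv).1
    have hpx : ∀ v ∈ R, pointInto e R x x v = false := by
      intro v hv
      by_cases h : e x v = true
      · simp [pointInto, hv, und, h, hsym v hv h]
      · simp [pointInto, hv, und, h]
    -- The chosen `x` need not be a sink of `G`. The induction survives because the hypotheses
    -- concern only the remaining nodes, where `e` is unchanged.
    obtain ⟨e', h₀, h₁, h₂, h₃, ⟨r, h₄⟩, h₅⟩ := extend_spec k (R.erase x) (pointInto e R x)
      (by rw [List.length_erase_of_mem hxR, hk]; rfl) (hnd.erase x)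
      (fun a ha b hb h => by
        rw [hmem] at ha hb
        rw [hp a b ha.1]; exact he a ha.2 b hb.2 h)
      (fun a ha b hb h => by
        rw [hmem] at ha hb
        rw [hp a b ha.1] at h; exact he' a ha.2 b hb.2 h)
      (fun a ha b hb c hcc => by
        rw [hmem] at ha hb hcc
        rw [hp b a hb.1]; exact hc a ha.2 b hb.2 c hcc.2)
    have hx1 : ∀ v ∈ R, e' x v = false := fun v hv => by
      rw [h₁ x v (.inl (by simp [hmem])), hpx v hv]
    have hx2 : ∀ v ∈ R, e' v x = e v x := fun v hv => by
      by_cases hvx : v = x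
      · subst hvx
        rw [hx1 v hv]
        by_contra h
        exact (he' v hv v hv (by simpa using Ne.symm h)).ne rfl
      · rw [h₁ v x (.inr (by simp [hmem])), hp v x hvx]
    have hadjx : ∀ v ∈ R, (e v x = true ↔ G.skeleton.Adj v x) := by
      refine fun v hv => ⟨he' v hv x hxR, fun h => ?_⟩
      rcases G.skeleton_adj.1 h with h | h
      · exact he v hv x hxR h
      · exact hsym v hv (he x hxR v hv h)
    -- The rank witnesses acyclicity: `x` has only incoming arcs, so it is put below all other
    -- remaining nodes.
    refine ⟨e', by rw [extend, hfind]; exact h₀, ?_, ?_, ?_,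
      ⟨fun v => if v = x then 0 else r v + 1, ?_⟩, ?_⟩
    · intro u v huv
      have : u ∉ R.erase x ∨ v ∉ R.erase x := huv.imp (mt List.mem_of_mem_erase)
        (mt List.mem_of_mem_erase)
      rw [h₁ u v this]
      by_cases hux : u = x
      · subst hux
        have hv : v ∉ R := huv.resolve_left fun h => h hxR
        simp [pointInto, hv]
      · exact hp u v hux
    · intro u hu v hv
      by_cases hux : u = x
      · subst hux
        rw [hx1 v hv, hx2 v hv, hadjx v hv, SimpleGraph.adj_comm]
        simp
      · by_cases hvx : v = x
        · subst hvx
          rw [hx1 u hu, hx2 u hu, hadjx u hu]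
          simp
        · exact h₂ u ((hmem u).2 ⟨hux, hu⟩) v ((hmem v).2 ⟨hvx, hv⟩)
    · intro u hu v hv h
      by_cases hux : u = x
      · subst hux
        simp [hx1 v hv] at h
      · by_cases hvx : v = x
        · subst hvx
          rwa [hx2 u hu] at h
        · have := h₃ u ((hmem u).2 ⟨hux, hu⟩) v ((hmem v).2 ⟨hvx, hv⟩) h
          rwa [hp u v hux] at this
    · intro u hu v hv h
      by_cases hux : u = x
      · subst hux
        simp [hx1 v hv] at h
      · by_cases hvx : v = x
        · simp [hux, hvx]
        · have := h₄ u ((hmem u).2 ⟨hux, hu⟩) v ((hmem v).2 ⟨hvx, hv⟩) h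
          simpa [hux, hvx] using this
    · intro a ha b hb c hcR hac hn hab hcb
      have hax : a ≠ x := by
        rintro rfl
        simp [hx1 b hb] at hab
      have hcx : c ≠ x := by
        rintro rfl
        simp [hx1 b hb] at hcb
      by_cases hbx : b = x
      · subst hbx
        rw [hx2 a ha] at hab
        rw [hx2 c hcR] at hcb
        -- If `G` had `b → a`, the edge would be undirected in `e`, and the sink condition would
        -- make `a` and `c` adjacent.
        have key : ∀ a ∈ R, ∀ c ∈ R, a ≠ c → ¬ G.skeleton.Adj a c → e a b = true →
            e c b = true → G.Adj a b := by
          intro a ha c hcR hac hn hab hcb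
          refine (G.skeleton_adj.1 (he' a ha b hb hab)).resolve_right fun hba => ?_
          have hund : und e b a = true := by simp [und, hab, he b hb a ha hba]
          rcases ((hsink a ha).2.resolve_left (by simp [hund]) c hcR) with (h | h) | h
          · simp [adjacent, hcb] at h
          · exact hac h.symm
          · simp only [adjacent, Bool.or_eq_true] at h
            exact hn (h.elim (he' a ha c hcR) fun h => (he' c hcR a ha h).symm)
        exact ⟨key a ha c hcR hac hn hab hcb,
          key c hcR a ha hac.symm (fun h => hn h.symm) hcb hab⟩
      · exact h₅ a ((hmem a).2 ⟨hax, ha⟩) b ((hmem b).2 ⟨hbx, hb⟩) c ((hmem c).2 ⟨hcx, hcR⟩)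
          hac hn hab hcb

/-- With a test that decides d-separation in `G`, the PC algorithm returns a DAG that is Markov
equivalent to `G`. -/
theorem run_returnsMarkovEquivalent [Finite V] (hnd : order.Nodup) (horder : ∀ v, v ∈ order)
    (hci : Decides ci G) : ReturnsMarkovEquivalent (run order ci) G := by
  obtain ⟨he₀, hc₀⟩ := orientColliders_spec horder hci
  obtain ⟨he, hc⟩ := applyRules_spec (order := order) he₀ hc₀
  obtain ⟨e, h₀, -, h₂, h₃, ⟨r, h₄⟩, h₅⟩ := extend_spec (G := G) order.length order _ rfl hnd
    (fun a _ b _ => he.of_adj a b) (fun a _ b _ => he.adj a b)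
    (fun x _ y _ z _ => hc x y z)
  have hlt : ∀ u v, Relation.TransGen (fun u v => e u v = true) u v → r v < r u := by
    intro u v h
    induction h with
    | single h => exact h₄ _ (horder _) _ (horder _) h
    | tail _ h ih => exact (h₄ _ (horder _) _ (horder _) h).trans ih
  let K : DAG V := { Adj := fun u v => e u v = true, acyclic := fun v h => (hlt v v h).false }
  refine ⟨K, by simp [run, runEdges, h₀, K], DAG.SamePattern.markovEquivalent ?_⟩
  have hskel : ∀ a b, K.skeleton.Adj a b ↔ G.skeleton.Adj a b := fun a b =>
    K.skeleton_adj.trans (h₂ a (horder a) b (horder b))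
  refine ⟨hskel, fun a b c hac hn => ?_⟩
  rw [hskel] at hn
  refine ⟨fun h => h₅ a (horder a) b (horder b) c (horder c) hac hn h.1 h.2, ?_⟩
  have key : ∀ a c, a ≠ c → ¬ G.skeleton.Adj a c → G.Adj a b → G.Adj c b → K.Adj a b := by
    intro a c hac hn ha hcb
    refine (K.skeleton_adj.1 ((hskel a b).2 (G.skeleton_adj.2 (.inl ha)))).resolve_right ?_
    intro hba
    have := h₃ b (horder b) a (horder a) hba
    rw [hc a b c hac hn ha hcb] at this
    cases this
  exact fun h => ⟨key a c hac hn h.1 h.2, key c a hac.symm (fun h => hn h.symm) h.2 h.1⟩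

end PC

/-! ### Merging groups into single variables -/

section MergedVariables

open MeasureTheory

variable {N : Type*} [Fintype N] [DecidableEq N] {X : N → Type*}

lemma Grouping.exists_group (W : Grouping N) (i : N) : ∃ J : W.Group, i ∈ J.1 := by
  obtain ⟨A, hA, hi⟩ := W.exists_mem (Finset.mem_univ i)
  exact ⟨⟨A, hA⟩, hi⟩

lemma Grouping.group_eq (W : Grouping N) {I J : W.Group} {i : N} (hI : i ∈ I.1) (hJ : i ∈ J.1) :
    I = J :=
  Subtype.ext (W.eq_of_mem_parts I.2 J.2 hI hJ)

/-- As the groups cover `N` without overlap, values of the new variables glue. Quantifiers over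
these values can thus be pulled back to the original variables. -/
lemma mergeGroups_surjective (W : Grouping N) :
    Function.Surjective (mergeGroups (X := X) W) := by
  intro y
  choose g hg using W.exists_group
  refine ⟨fun i => y (g i) ⟨i, hg i⟩, ?_⟩
  funext J i
  have key : ∀ I (h : i.1 ∈ I.1), I = J → y I ⟨i, h⟩ = y J i := by
    rintro _ _ rfl
    rfl
  exact key _ _ (W.group_eq (hg i) i.2)

lemma preimage_valueEvent_mergeGroups (W : Grouping N) (S : Finset W.Group) (a : ∀ i, X i) :
    mergeGroups W ⁻¹' valueEvent S (mergeGroups W a) =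
      valueEvent (S.biUnion fun K => K.1) a := by
  ext x
  simp only [valueEvent, Set.mem_preimage, Set.mem_ofPred_eq, Finset.mem_biUnion, mergeGroups,
    funext_iff, Subtype.forall]
  constructor
  · rintro h i ⟨K, hK, hi⟩
    exact h K.1 K.2 hK i hi
  · exact fun h K hK hKS i hi => h i ⟨⟨K, hK⟩, hKS, hi⟩

lemma measurable_mergeGroups [∀ i, MeasurableSpace (X i)] (W : Grouping N) :
    Measurable (mergeGroups (X := X) W) := by
  unfold mergeGroups
  fun_prop

/-- Converting independent records gives independent records of the new variables. -/
lemma map_pi_mergeGroups [∀ i, MeasurableSpace (X i)] (W : Grouping N)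
    (p : Measure (∀ i, X i)) [IsProbabilityMeasure p] (n : ℕ) :
    (Measure.pi fun _ : Fin n => p).map (fun D t => mergeGroups W (D t)) =
      Measure.pi fun _ : Fin n => p.map (mergeGroups W) :=
  Measure.pi_map_pi fun _ => (measurable_mergeGroups W).aemeasurable

variable [∀ i, Countable (X i)] [∀ i, MeasurableSpace (X i)] [∀ i, DiscreteMeasurableSpace (X i)]

/-- Conditional independence of new variables is conditional independence of the groups. -/
lemma condIndepVars_map_mergeGroups (W : Grouping N) (p : Measure (∀ i, X i))
    (A B S : Finset W.Group) :
    CondIndepVars (X := GroupState X W) (p.map (mergeGroups W)) A B S ↔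
      CondIndepVars p (A.biUnion fun K => K.1) (B.biUnion fun K => K.1)
        (S.biUnion fun K => K.1) := by
  have hm := measurable_mergeGroups (X := X) W
  have hmeas : ∀ s : Set (∀ J, GroupState X W J), MeasurableSet s := fun s =>
    s.to_countable.measurableSet
  have hmeas' : ∀ s : Set (∀ i, X i), MeasurableSet s := fun s => s.to_countable.measurableSet
  unfold CondIndepVars
  simp only [(mergeGroups_surjective W).forall, ProbabilityTheory.cond_apply (hmeas _),
    ProbabilityTheory.cond_apply (hmeas' _), Measure.map_apply hm (hmeas _), Set.preimage_inter,
    preimage_valueEvent_mergeGroups]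

/-- Conditional independence of two new variables, expressed by d-separation in a group DAG to
which the distribution is groupwise faithful. -/
lemma GroupwiseFaithful.condIndepVars_iff {W : Grouping N} {p : Measure (∀ i, X i)}
    {G : DAG W.Group} (h : GroupwiseFaithful p W G) {u v : W.Group} {S : Finset W.Group}
    (huv : u ≠ v) (hu : u ∉ S) (hv : v ∉ S) :
    CondIndepVars (X := GroupState X W) (p.map (mergeGroups W)) {u} {v} S ↔
      G.DSep u v S := by
  rw [condIndepVars_map_mergeGroups, Finset.singleton_biUnion, Finset.singleton_biUnion]
  exact h u v S huv hu hv

end MergedVariables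

/-- Finitely many events whose probabilities tend to one occur jointly with a probability that
tends to one. -/
lemma MeasureTheory.tendsto_measure_iInter_one {ι : Type*} [Finite ι] {Ω : ℕ → Type*}
    [∀ n, MeasurableSpace (Ω n)] (μ : ∀ n, Measure (Ω n)) [∀ n, IsProbabilityMeasure (μ n)]
    (E : ι → ∀ n, Set (Ω n)) (hE : ∀ i n, MeasurableSet (E i n))
    (h : ∀ i, Filter.Tendsto (fun n => μ n (E i n)) Filter.atTop (nhds 1)) :
    Filter.Tendsto (fun n => μ n (⋂ i, E i n)) Filter.atTop (nhds 1) := by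
  have := Fintype.ofFinite ι
  have hcompl : ∀ i, Filter.Tendsto (fun n => μ n (E i n)ᶜ) Filter.atTop (nhds 0) := by
    intro i
    have := ENNReal.Tendsto.sub (tendsto_const_nhds (x := (1 : ENNReal)) (f := Filter.atTop))
      (h i) (.inl ENNReal.one_ne_top)
    simpa [prob_compl_eq_one_sub (hE i _)] using this
  -- The union bound over the complements gives this lower bound.
  have hsum : Filter.Tendsto (fun n => 1 - ∑ i, μ n (E i n)ᶜ) Filter.atTop (nhds 1) := by
    have h0 : Filter.Tendsto (fun n => ∑ i, μ n (E i n)ᶜ) Filter.atTop (nhds 0) := by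
      simpa using tendsto_finsetSum Finset.univ fun i _ => hcompl i
    simpa using ENNReal.Tendsto.sub (tendsto_const_nhds (x := (1 : ENNReal)) (f := Filter.atTop))
      h0 (.inl ENNReal.one_ne_top)
  refine tendsto_of_tendsto_of_tendsto_of_le_of_le hsum tendsto_const_nhds (fun n => ?_)
    fun n => prob_le_one
  rw [tsub_le_iff_right, ← prob_add_prob_compl (μ := μ n) (MeasurableSet.iInter fun i => hE i n),
    Set.compl_iInter]
  exact add_le_add le_rfl (measure_iUnion_fintype_le _ _)

theorem mainTheorem5 {N : Type*} [Fintype N] [DecidableEq N] {X : N → Type*}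
    [∀ i, Countable (X i)] [∀ i, MeasurableSpace (X i)] [∀ i, DiscreteMeasurableSpace (X i)]
    (p : MeasureTheory.Measure (∀ i, X i)) [MeasureTheory.IsProbabilityMeasure p]
    (B : BayesianNetwork N X) (hB : B.Represents p)
    (W : Grouping N) (G' : DAG W.Group) (hfaithful : GroupwiseFaithful p W G')
    (order : List W.Group) (horder : order.Nodup) (hcomplete : ∀ J : W.Group, J ∈ order) :
    ReturnsMarkovEquivalent (findGroupDAG1Population W order p) G' ∧
    ∀ τ : CITest (GroupState X W), τ.ConsistentAt (p.map (mergeGroups W)) →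
      Filter.Tendsto
        (fun n : ℕ => MeasureTheory.Measure.pi (fun _ : Fin n => p)
          {D | ReturnsMarkovEquivalent (findGroupDAG1 W order τ D) G'})
        Filter.atTop (nhds 1) := by
  have : ∀ n, Countable (Fin n → ∀ i, X i) := fun n => inferInstance
  have hmeas : ∀ n, ∀ s : Set (Fin n → ∀ i, X i), MeasurableSet s := fun n s =>
    s.to_countable.measurableSet
  refine ⟨PC.run_returnsMarkovEquivalent horder hcomplete fun u v S huv hu hv => ?_,
    fun τ hτ => ?_⟩
  · exact (@decide_eq_true_iff _ (Classical.propDecidable _)).trans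
      (hfaithful.condIndepVars_iff huv hu hv)
  · let q := p.map (mergeGroups W)
    -- The finite set of all admissible queries. Where all are answered correctly, the test is a
    -- d-separation oracle for `G'`.
    let I := {t : W.Group × W.Group × Finset W.Group // t.1 ≠ t.2.1 ∧ t.1 ∉ t.2.2 ∧ t.2.1 ∉ t.2.2}
    let E : I → ∀ n, Set (Fin n → ∀ i, X i) := fun t n =>
      {D | τ n (fun k => mergeGroups W (D k)) t.1.1 t.1.2.1 t.1.2.2 = true ↔
        CondIndepVars q {t.1.1} {t.1.2.1} t.1.2.2}
    have hE : ∀ t, Filter.Tendsto (fun n => MeasureTheory.Measure.pi (fun _ : Fin n => p) (E t n))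
        Filter.atTop (nhds 1) := by
      intro t
      refine (hτ t.1.1 t.1.2.1 t.1.2.2 t.2.1 t.2.2.1 t.2.2.2).congr fun n => ?_
      rw [← map_pi_mergeGroups, MeasureTheory.Measure.map_apply]
      · rfl
      · exact measurable_pi_lambda _ fun k =>
          (measurable_mergeGroups W).comp (measurable_pi_apply k)
      · exact (Set.to_countable _).measurableSet
    refine tendsto_of_tendsto_of_tendsto_of_le_of_le
      (MeasureTheory.tendsto_measure_iInter_one _ E (fun t n => hmeas n _) hE) tendsto_const_nhds
      (fun n => MeasureTheory.measure_mono fun D hD => ?_) fun n => MeasureTheory.prob_le_one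
    refine PC.run_returnsMarkovEquivalent horder hcomplete fun u v S huv hu hv => ?_
    exact (Set.mem_iInter.1 hD ⟨(u, v, S), huv, hu, hv⟩).trans
      (hfaithful.condIndepVars_iff huv hu hv)
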